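/- Let $X$ and $Y$ be complex Banach spaces and let $A\in L(X)$, $B\in L(Y)$ be bounded linear operators. A bounded operator $T$ on a complex Banach space $Z$ has the single-valued extension property (SVEP) if for every $\lambda\in\mathbb{C}$ and every connected open neighbourhood $U$ of $\lambda$ the only analytic function $f:U\to Z$ with $(T-\mu I)f(\mu)=0$ for all $\mu\in U$ is $f\equiv 0$. The operator $T$ is called Weyl if it is Fredholm of index $\dim\mathcal N(T)-\operatorname{codim}\mathcal R(T)=0$, and quasi-nilpotent if its spectral radius is $0$. It is called pseudo B-Weyl if there are closed $T$-invariant subspaces $Z_1,Z_2$ with $Z=Z_1\oplus Z_2$ such that $T|_{Z_1}$ is Weyl and $T|_{Z_2}$ is quasi-nilpotent. The pseudo B-Weyl spectrum of $T$ is $\sigma_{pBW}(T)=\{\lambda\in\mathbb{C}: T-\lambda I \text{ is not pseudo B-Weyl}\}$. For $C\in L(Y,X)$ let $M_C=\begin{pmatrix}A&C\\0&B\end{pmatrix}$ be the operator on $X\oplus Y$ given by $M_C(x,y)=(Ax+Cy,By)$. If $A$ and $B$ both have SVEP, or if the Banach space adjoints $A^*$ (on $X^*$) and $B^*$ (on $Y^*$)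 both have SVEP, then for every $C\in L(Y,X)$ $$\sigma_{pBW}(M_C)=\sigma_{pBW}(A)\cup\sigma_{pBW}(B).$$ -/

import Mathlib

open Set

namespace PseudoBWeyl

section Operators

variable {X : Type*} [NormedAddCommGroup X] [NormedSpace ℂ X]
variable {Y : Type*} [NormedAddCommGroup Y] [NormedSpace ℂ Y]

/-- `T` has the single-valued extension property at `z`: on every (connected) open neighbourhood
`U` of `z`, the only analytic `f : U → X` with `(T - w I) f w = 0` for all `w ∈ U` is `f = 0`.
Connectedness makes the notion local at `z`. It is immaterial for the SVEP at all points,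
see `hasSVEP_iff`. -/
def HasSVEPAt (T : X →L[ℂ] X) (z : ℂ) : Prop :=
  ∀ U : Set ℂ, IsOpen U → IsPreconnected U → z ∈ U →
    ∀ f : ℂ → X, AnalyticOnNhd ℂ f U →
      (∀ w ∈ U, (T - w • ContinuousLinearMap.id ℂ X) (f w) = 0) → ∀ w ∈ U, f w = 0

/-- The set of the points at which `T` fails to have the single-valued extension property. -/
def svepFailureSet (T : X →L[ℂ] X) : Set ℂ := {z | ¬ HasSVEPAt T z}

/-- `T` has the single-valued extension property. -/
def HasSVEP (T : X →L[ℂ] X) : Prop := svepFailureSet T = ∅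

/-- The single-valued extension property, with arbitrary open sets instead of connected ones. -/
theorem hasSVEP_iff (T : X →L[ℂ] X) :
    HasSVEP T ↔ ∀ U : Set ℂ, IsOpen U → ∀ f : ℂ → X, AnalyticOnNhd ℂ f U →
      (∀ w ∈ U, (T - w • ContinuousLinearMap.id ℂ X) (f w) = 0) → ∀ w ∈ U, f w = 0 := by
  constructor
  · intro h U hU f hf hz w hw
    have hT : HasSVEPAt T w := by
      by_contra hc
      have hmem : w ∈ svepFailureSet T := hc
      rw [show svepFailureSet T = ∅ from h] at hmem
      exact hmem
    obtain ⟨r, hr, hball⟩ := Metric.isOpen_iff.1 hU w hw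
    exact hT (Metric.ball w r) Metric.isOpen_ball (convex_ball w r).isPreconnected
      (Metric.mem_ball_self hr) f (hf.mono hball) (fun v hv => hz v (hball hv)) w
      (Metric.mem_ball_self hr)
  · intro h
    refine eq_empty_iff_forall_notMem.2 fun z hz => hz ?_
    intro U hU _ _ f hf hw
    exact h U hU f hf hw

/-- The Banach space adjoint `T* : X* → X*`, `φ ↦ φ ∘ T`, on the normed dual of `X`. -/
noncomputable def dualOp (T : X →L[ℂ] X) : StrongDual ℂ X →L[ℂ] StrongDual ℂ X :=
  ContinuousLinearMap.precomp ℂ T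

/-- `ind T = n(T) - d(T)`, with `n(T) = dim N(T)` and `d(T) = codim R(T)`;
meaningful when both are finite. -/
noncomputable def index (T : X →L[ℂ] X) : ℤ :=
  (Module.finrank ℂ (LinearMap.ker (T : X →ₗ[ℂ] X)) : ℤ) -
    (Module.finrank ℂ (X ⧸ LinearMap.range (T : X →ₗ[ℂ] X)) : ℤ)

/-- A Weyl operator is a Fredholm operator of index zero. -/
def IsWeyl (T : X →L[ℂ] X) : Prop := T.IsFredholm ∧ index T = 0

/-- `T` is quasi-nilpotent: its spectral radius is zero. This is `σ(T) = {0}` unless `X` is the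
zero space, where it holds as well. -/
def IsQuasiNilpotent (T : X →L[ℂ] X) : Prop := spectralRadius ℂ T = 0

/-- `T` is pseudo B-Weyl: `X = X₁ ⊕ X₂` with closed `T`-invariant subspaces such that the
restriction of `T` to `X₁` is Weyl and the restriction to `X₂` is quasi-nilpotent. -/
def IsPseudoBWeyl (T : X →L[ℂ] X) : Prop :=
  ∃ (X₁ X₂ : Submodule ℂ X) (h₁ : MapsTo T X₁ X₁) (h₂ : MapsTo T X₂ X₂),
    IsClosed (X₁ : Set X) ∧ IsClosed (X₂ : Set X) ∧ IsCompl X₁ X₂ ∧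
      IsWeyl (T.restrict h₁) ∧ IsQuasiNilpotent (T.restrict h₂)

/-- The pseudo B-Weyl spectrum. -/
def pBWSpectrum (T : X →L[ℂ] X) : Set ℂ :=
  {z | ¬ IsPseudoBWeyl (T - z • ContinuousLinearMap.id ℂ X)}

/-- The upper triangular operator matrix `(x, y) ↦ (A x + C y, B y)` on `X ⊕ Y`. -/
def upperTriangular (A : X →L[ℂ] X) (B : Y →L[ℂ] Y) (C : Y →L[ℂ] X) : X × Y →L[ℂ] X × Y :=
  (A ∘L ContinuousLinearMap.fst ℂ X Y + C ∘L ContinuousLinearMap.snd ℂ X Y).prod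
    (B ∘L ContinuousLinearMap.snd ℂ X Y)

end Operators

end PseudoBWeyl

/-!
The pseudo B-Weyl spectrum of an operator `T` such that `T` or `T*` has the single-valued extension
property (SVEP) is the set of accumulation points of its spectrum (`notMem_pBWSpectrum_iff`), and
under the hypotheses the spectrum of the operator matrix is the union of the spectra of its diagonal
entries (`isUnit_upperTriangular_iff`). Since the accumulation points of a union of two sets are
those of one or the other, the theorem follows.

For the first fact, let `0` not be an accumulation point of the spectrum of `T`. The Laurent
coefficients `mₙ = (2πi)⁻¹ ∮ wⁿ (w - T)⁻¹ dw` satisfy `T mₙ = mₙ₊₁` for `n ≠ -1` and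
`T m₋₁ = m₀ - 1`, hence `(m₀ - 1) m₀ = m₋ₖ mₖ` for all `k ≥ 1`. Estimating `mₖ` on a smaller circle
than `m₋ₖ` shows that this is `0`. So `m₀` is idempotent, and it splits `T` into an invertible
operator and a quasi-nilpotent one (`exists_riesz_idempotent`).

Conversely, let `T` be the direct sum of a Weyl operator `T₁` and a quasi-nilpotent one. The SVEP
of `T` or `T*` passes to `T₁` or `T₁*`. As `T₁` is Weyl, `T₁ + i p` is invertible for some
`i : ℂᵈ → X₁` and `p : X₁ → ℂᵈ`, so for small `w` the invertibility of `T₁ - w` is that of a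
`d × d` matrix analytic in `w`. If its determinant vanished near `0`, linear algebra over the
domain of analytic germs would give analytic left and right null vectors, which contradict the SVEP
of `T₁*` and of `T₁` respectively (`eventually_isUnit_sub_smul_of_isUnit_add`). So the determinant
has an isolated zero at most.

For the second fact, if the operator matrix is invertible, then `A` is left invertible and `B` is
right invertible. A right invertible operator with the SVEP is invertible
(`HasSVEP.injective_of_mul_eq_one`); applied to `B` or to `A*`, this makes one diagonal entry
invertible, and then the other one is invertible as well.
-/

open Filter Topology

namespace PseudoBWeyl

/-! ### The single-valued extension property -/

section SVEP

variable {X : Type*} [NormedAddCommGroup X] [NormedSpace ℂ X]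
variable {Y : Type*} [NormedAddCommGroup Y] [NormedSpace ℂ Y]

theorem HasSVEP.sub_smul {T : X →L[ℂ] X} (h : HasSVEP T) (z : ℂ) :
    HasSVEP (T - z • ContinuousLinearMap.id ℂ X) := by
  rw [hasSVEP_iff] at h ⊢
  intro U hU f hf hz w hw
  have key := h ((fun v => v - z) ⁻¹' U) (hU.preimage (by fun_prop)) (fun v => f (v - z)) ?_ ?_
    (w + z) (by simpa using hw)
  · simpa using key
  · intro v hv
    exact (hf (v - z) hv).comp_of_eq (f := fun v => v - z) (by fun_prop) rfl
  · intro v hv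
    have := hz (v - z) hv
    rw [← this]
    simp
    module

/-- The SVEP passes to any operator embedded in `T` by an injective intertwiner, such as the
restriction of `T` to an invariant subspace. -/
theorem HasSVEP.of_intertwines {T : X →L[ℂ] X} (h : HasSVEP T) {S : Y →L[ℂ] Y} (J : Y →L[ℂ] X)
    (hJ : Function.Injective J) (hTS : ∀ y, T (J y) = J (S y)) : HasSVEP S := by
  rw [hasSVEP_iff] at h ⊢
  intro U hU f hf hz w hw
  refine hJ ?_
  rw [map_zero]
  refine h U hU (fun v => J (f v)) (fun v hv => (J.analyticAt _).comp (hf v hv)) ?_ w hw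
  intro v hv
  have := congrArg J (hz v hv)
  simpa [hTS] using this

theorem dualOp_sub_smul (T : X →L[ℂ] X) (z : ℂ) :
    dualOp (T - z • ContinuousLinearMap.id ℂ X) =
      dualOp T - z • ContinuousLinearMap.id ℂ (StrongDual ℂ X) := by
  ext φ x
  simp [dualOp]

/-- A right invertible operator with the SVEP is injective: if `T x = 0` and `T R = 1`, then
`w ↦ (1 - w R)⁻¹ x` is an analytic family of eigenvectors near `0`. -/
theorem HasSVEP.injective_of_mul_eq_one [CompleteSpace X] {T R : X →L[ℂ] X} (h : HasSVEP T)
    (hTR : T * R = 1) : Function.Injective T := by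
  rw [hasSVEP_iff] at h
  rw [injective_iff_map_eq_zero]
  intro x hx
  have hU : IsOpen {w : ℂ | IsUnit (1 - w • R)} :=
    Units.isOpen.preimage (f := fun w : ℂ => 1 - w • R) (by fun_prop)
  have := h _ hU (fun w => Ring.inverse (1 - w • R) x) ?_ ?_ 0 (by simp)
  · simpa using this
  · rintro w ⟨u, hu⟩
    have h1 : AnalyticAt ℂ (fun w : ℂ => Ring.inverse (1 - w • R)) w :=
      AnalyticAt.comp_of_eq (f := fun w : ℂ => 1 - w • R) (analyticAt_inverse (𝕜 := ℂ) u)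
        (by fun_prop) hu.symm
    exact ((ContinuousLinearMap.apply ℂ X x).analyticAt _).comp h1
  · intro w hw
    have h2 : T - w • ContinuousLinearMap.id ℂ X = T * (1 - w • R) := by
      rw [mul_sub, mul_smul_comm, hTR, mul_one]; rfl
    rw [h2, ← mul_apply_eq_comp, mul_assoc, Ring.mul_inverse_cancel _ hw, mul_one, hx]

/-- A left invertible operator whose adjoint has the SVEP is invertible: if `L T = 1`, then
`T* L* = 1`, so that `T*` is injective and kills every functional vanishing on the range of the
idempotent `T L`. -/
theorem mul_eq_one_of_hasSVEP_dualOp {T L : X →L[ℂ] X} (h : HasSVEP (dualOp T))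
    (hLT : L * T = 1) : T * L = 1 := by
  have h1 : dualOp T * dualOp L = 1 := by
    ext φ x
    have : L (T x) = x := by simpa using congrArg (fun S : X →L[ℂ] X => S x) hLT
    simp [dualOp, this]
  have hinj := h.injective_of_mul_eq_one h1
  rw [injective_iff_map_eq_zero] at hinj
  ext x
  rw [← sub_eq_zero]
  refine SeparatingDual.eq_zero_of_forall_dual_eq_zero (R := ℂ) fun φ => ?_
  have h2 := hinj (φ ∘L (T * L - 1)) (by
    ext y
    have : L (T y) = y := by simpa using congrArg (fun S : X →L[ℂ] X => S y) hLT
    simp [dualOp, this])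
  simpa using congrArg (fun ψ : StrongDual ℂ X => ψ x) h2

end SVEP

/-! ### Upper triangular operator matrices -/

section UpperTriangular

variable {X : Type*} [NormedAddCommGroup X] [NormedSpace ℂ X]
variable {Y : Type*} [NormedAddCommGroup Y] [NormedSpace ℂ Y]

@[simp]
theorem upperTriangular_apply (A : X →L[ℂ] X) (B : Y →L[ℂ] Y) (C : Y →L[ℂ] X) (q : X × Y) :
    upperTriangular A B C q = (A q.1 + C q.2, B q.2) := rfl

theorem upperTriangular_sub_smul (A : X →L[ℂ] X) (B : Y →L[ℂ] Y) (C : Y →L[ℂ] X) (z : ℂ) :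
    upperTriangular A B C - z • ContinuousLinearMap.id ℂ (X × Y) =
      upperTriangular (A - z • ContinuousLinearMap.id ℂ X) (B - z • ContinuousLinearMap.id ℂ Y)
        C := by
  refine ContinuousLinearMap.ext fun q => Prod.ext ?_ ?_
  · simp; abel
  · simp

theorem hasSVEP_upperTriangular {A : X →L[ℂ] X} {B : Y →L[ℂ] Y} (hA : HasSVEP A)
    (hB : HasSVEP B) (C : Y →L[ℂ] X) : HasSVEP (upperTriangular A B C) := by
  rw [hasSVEP_iff] at hA hB ⊢
  intro U hU f hf hz
  have hz' : ∀ w ∈ U, A (f w).1 + C (f w).2 - w • (f w).1 = 0 ∧ B (f w).2 - w • (f w).2 = 0 :=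
    fun w hw => by simpa [Prod.ext_iff] using hz w hw
  have h2 : ∀ w ∈ U, (f w).2 = 0 := hB U hU (fun w => (f w).2)
    (fun w hw => analyticAt_snd.comp (hf w hw)) fun w hw => by simpa using (hz' w hw).2
  have h1 : ∀ w ∈ U, (f w).1 = 0 := hA U hU (fun w => (f w).1)
    (fun w hw => analyticAt_fst.comp (hf w hw))
    fun w hw => by simpa [h2 w hw] using (hz' w hw).1
  exact fun w hw => Prod.ext (h1 w hw) (h2 w hw)

theorem _root_.AnalyticAt.comp_continuousLinearMap_right {f : ℂ → StrongDual ℂ X} {w : ℂ}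
    (hf : AnalyticAt ℂ f w) (J : Y →L[ℂ] X) : AnalyticAt ℂ (fun v => f v ∘L J) w :=
  AnalyticAt.comp (g := fun φ : StrongDual ℂ X => φ ∘L J)
    ((ContinuousLinearMap.precomp ℂ J).analyticAt (f w)) hf

theorem hasSVEP_dualOp_upperTriangular {A : X →L[ℂ] X} {B : Y →L[ℂ] Y}
    (hA : HasSVEP (dualOp A)) (hB : HasSVEP (dualOp B)) (C : Y →L[ℂ] X) :
    HasSVEP (dualOp (upperTriangular A B C)) := by
  rw [hasSVEP_iff] at hA hB ⊢
  intro U hU f hf hz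
  have hz' : ∀ w ∈ U, ∀ x y, f w (A x + C y, B y) - w • f w (x, y) = 0 := fun w hw x y => by
    simpa [dualOp] using congrArg (fun φ : StrongDual ℂ (X × Y) => φ (x, y)) (hz w hw)
  have h1 : ∀ w ∈ U, f w ∘L ContinuousLinearMap.inl ℂ X Y = 0 :=
    hA U hU (fun w => f w ∘L ContinuousLinearMap.inl ℂ X Y)
      (fun w hw => (hf w hw).comp_continuousLinearMap_right _) fun w hw => by
        ext x
        simpa [dualOp] using hz' w hw x 0
  have h1' : ∀ w ∈ U, ∀ x, f w (x, 0) = 0 := fun w hw x => by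
    simpa using congrArg (fun φ : StrongDual ℂ X => φ x) (h1 w hw)
  have h2 : ∀ w ∈ U, f w ∘L ContinuousLinearMap.inr ℂ X Y = 0 :=
    hB U hU (fun w => f w ∘L ContinuousLinearMap.inr ℂ X Y)
      (fun w hw => (hf w hw).comp_continuousLinearMap_right _) fun w hw => by
        ext y
        have h3 := hz' w hw 0 y
        have h4 : f w (A 0 + C y, B y) = f w (0, B y) := by
          have : ((A 0 + C y, B y) : X × Y) = (C y, 0) + (0, B y) := by simp
          rw [this, map_add, h1' w hw, zero_add]
        rw [h4] at h3
        simpa [dualOp] using h3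
  have h2' : ∀ w ∈ U, ∀ y, f w (0, y) = 0 := fun w hw y => by
    simpa using congrArg (fun φ : StrongDual ℂ Y => φ y) (h2 w hw)
  intro w hw
  refine ContinuousLinearMap.ext fun q => ?_
  have : q = (q.1, 0) + (0, q.2) := by simp
  rw [this, map_add, h1' w hw, h2' w hw]
  simp

/-- Under the SVEP hypothesis, the spectrum of the operator matrix is the union of the spectra of
its diagonal entries. -/
theorem isUnit_upperTriangular_iff [CompleteSpace X] [CompleteSpace Y] {A : X →L[ℂ] X}
    {B : Y →L[ℂ] Y} (h : HasSVEP B ∨ HasSVEP (dualOp A)) (C : Y →L[ℂ] X) :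
    IsUnit (upperTriangular A B C) ↔ IsUnit A ∧ IsUnit B := by
  constructor
  · intro hM
    obtain ⟨⟨M, N, hMN, hNM⟩, rfl : M = _⟩ := hM
    have hM' := (ContinuousLinearMap.isUnit_iff_bijective (f := upperTriangular A B C)).1
      ⟨⟨_, N, hMN, hNM⟩, rfl⟩
    have hAinj : Function.Injective A := by
      rw [injective_iff_map_eq_zero]
      intro x hx
      have := hM'.1 (a₁ := (x, 0)) (a₂ := 0) (by simp [hx])
      simpa using this
    have hBsurj : Function.Surjective B := fun y => by
      obtain ⟨q, hq⟩ := hM'.2 (0, y)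
      exact ⟨q.2, congrArg Prod.snd hq⟩
    have hMNq : ∀ q, upperTriangular A B C (N q) = q := fun q => by
      simpa using congrArg (fun S : X × Y →L[ℂ] X × Y => S q) hMN
    have hNMq : ∀ q, N (upperTriangular A B C q) = q := fun q => by
      simpa using congrArg (fun S : X × Y →L[ℂ] X × Y => S q) hNM
    rcases h with hB | hA
    · have hBinj : Function.Injective B := by
        refine hB.injective_of_mul_eq_one (R := ContinuousLinearMap.snd ℂ X Y ∘L N ∘L
          ContinuousLinearMap.inr ℂ X Y) ?_
        ext y
        exact congrArg Prod.snd (hMNq (0, y))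
      refine ⟨ContinuousLinearMap.isUnit_iff_bijective.2 ⟨hAinj, fun x => ?_⟩,
        ContinuousLinearMap.isUnit_iff_bijective.2 ⟨hBinj, hBsurj⟩⟩
      obtain ⟨q, hq⟩ := hM'.2 (x, 0)
      have h2 : q.2 = 0 := hBinj (by simpa using congrArg Prod.snd hq)
      exact ⟨q.1, by simpa [h2] using congrArg Prod.fst hq⟩
    · have hAsurj : Function.Surjective A := by
        have := mul_eq_one_of_hasSVEP_dualOp hA (L := ContinuousLinearMap.fst ℂ X Y ∘L N ∘L
          ContinuousLinearMap.inl ℂ X Y) (by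
            ext x
            have := congrArg Prod.fst (hNMq (x, 0))
            simpa using this)
        exact fun x => ⟨_, congrArg (fun S : X →L[ℂ] X => S x) this⟩
      refine ⟨ContinuousLinearMap.isUnit_iff_bijective.2 ⟨hAinj, hAsurj⟩,
        ContinuousLinearMap.isUnit_iff_bijective.2 ⟨?_, hBsurj⟩⟩
      rw [injective_iff_map_eq_zero]
      intro y hy
      obtain ⟨x, hx⟩ := hAsurj (-C y)
      have := hM'.1 (a₁ := (x, y)) (a₂ := 0) (by simp [hx, hy])
      exact congrArg Prod.snd this
  · rintro ⟨hA, hB⟩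
    rw [ContinuousLinearMap.isUnit_iff_bijective] at hA hB ⊢
    constructor
    · rw [injective_iff_map_eq_zero]
      rintro ⟨x, y⟩ hq
      simp only [upperTriangular_apply, Prod.mk_eq_zero] at hq
      have hy : y = 0 := hB.1 (by simpa using hq.2)
      subst hy
      exact Prod.ext (hA.1 (by simpa using hq.1)) rfl
    · rintro ⟨x, y⟩
      obtain ⟨y', hy⟩ := hB.2 y
      obtain ⟨x', hx⟩ := hA.2 (x - C y')
      exact ⟨(x', y'), by simp [hx, hy]⟩

end UpperTriangular

/-! ### The Riesz idempotent of an isolated point of the spectrum -/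

section Riesz

open Complex Metric

variable {𝔸 : Type*} [NormedRing 𝔸] [NormedAlgebra ℂ 𝔸] [CompleteSpace 𝔸]

/-- The moment `(2πi)⁻¹ ∮ wⁿ (w - a)⁻¹ dw` over the circle of radius `ρ` around `0`, that is,
the Laurent coefficient of index `-n - 1` of the resolvent of `a` at `0`. -/
noncomputable def resolventMoment (a : 𝔸) (ρ : ℝ) (n : ℤ) : 𝔸 :=
  (2 * Real.pi * I : ℂ)⁻¹ • ∮ w in C(0, ρ), w ^ n • resolvent a w

variable {a : 𝔸} {r ρ : ℝ}

theorem differentiableAt_zpow_smul_resolvent {w : ℂ} (hw : w ≠ 0) (h : w ∈ resolventSet ℂ a)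
    (n : ℤ) : DifferentiableAt ℂ (fun w : ℂ => w ^ n • resolvent a w) w :=
  (differentiableAt_zpow.2 (Or.inl hw)).smul
    (spectrum.hasDerivAt_resolvent_const_left h).differentiableAt

theorem resolventMoment_eq_of_le (h : ∀ w : ℂ, w ≠ 0 → ‖w‖ < r → w ∈ resolventSet ℂ a)
    {ρ' : ℝ} (h0 : 0 < ρ) (hle : ρ ≤ ρ') (hr : ρ' < r) (n : ℤ) :
    resolventMoment a ρ' n = resolventMoment a ρ n := by
  unfold resolventMoment
  congr 1
  have hd : ∀ w : ℂ, w ∈ closedBall (0 : ℂ) ρ' \ ball 0 ρ →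
      DifferentiableAt ℂ (fun w : ℂ => w ^ n • resolvent a w) w := by
    rintro w ⟨h1, h2⟩
    simp only [mem_closedBall, dist_zero_right, mem_ball, not_lt] at h1 h2
    have hw : w ≠ 0 := norm_pos_iff.1 (h0.trans_le h2)
    exact differentiableAt_zpow_smul_resolvent hw (h w hw (h1.trans_lt hr)) n
  refine circleIntegral_eq_of_differentiable_on_annulus_off_countable h0 hle countable_empty
    (fun w hw => (hd w hw).continuousAt.continuousWithinAt) fun w hw => hd w ?_
  exact ⟨ball_subset_closedBall hw.1.1, fun hc => hw.1.2 (ball_subset_closedBall hc)⟩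

theorem continuousOn_zpow_smul_resolvent
    (h : ∀ w : ℂ, w ≠ 0 → ‖w‖ < r → w ∈ resolventSet ℂ a) (h0 : 0 < ρ) (hr : ρ < r) (n : ℤ) :
    ContinuousOn (fun w : ℂ => w ^ n • resolvent a w) (sphere 0 ρ) := by
  intro w hw
  simp only [mem_sphere, dist_zero_right] at hw
  have hw0 : w ≠ 0 := norm_pos_iff.1 (hw ▸ h0)
  exact (differentiableAt_zpow_smul_resolvent hw0 (h w hw0 (hw ▸ hr))
    n).continuousAt.continuousWithinAt

/-- A bounded linear map may be applied under the integral sign of a moment. -/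
theorem map_resolventMoment (h : ∀ w : ℂ, w ≠ 0 → ‖w‖ < r → w ∈ resolventSet ℂ a)
    (h0 : 0 < ρ) (hr : ρ < r) (n : ℤ) (Φ : 𝔸 →L[ℂ] 𝔸) :
    Φ (resolventMoment a ρ n) =
      (2 * Real.pi * I : ℂ)⁻¹ • ∮ w in C(0, ρ), Φ (w ^ n • resolvent a w) := by
  have hi := ((continuousOn_zpow_smul_resolvent h h0 hr n).circleIntegrable h0.le).out
  rw [resolventMoment, map_smul, circleIntegral, circleIntegral,
    ← Φ.intervalIntegral_comp_comm hi]
  simp only [map_smul]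

theorem commute_resolventMoment (h : ∀ w : ℂ, w ≠ 0 → ‖w‖ < r → w ∈ resolventSet ℂ a)
    (h0 : 0 < ρ) (hr : ρ < r) (n : ℤ) : Commute a (resolventMoment a ρ n) := by
  have h1 := map_resolventMoment h h0 hr n (ContinuousLinearMap.mul ℂ 𝔸 a)
  have h2 := map_resolventMoment h h0 hr n ((ContinuousLinearMap.mul ℂ 𝔸).flip a)
  simp only [ContinuousLinearMap.mul_apply', ContinuousLinearMap.flip_apply] at h1 h2
  rw [Commute, SemiconjBy, h1, h2]
  congr 1
  refine circleIntegral.integral_congr h0.le fun w hw => ?_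
  simp only [mem_sphere, dist_zero_right] at hw
  have hu := h w (norm_pos_iff.1 (hw ▸ h0)) (hw ▸ hr)
  have e₁ : (algebraMap ℂ 𝔸 w - a) * resolvent a w = 1 := Ring.mul_inverse_cancel _ hu
  have e₂ : resolvent a w * (algebraMap ℂ 𝔸 w - a) = 1 := Ring.inverse_mul_cancel _ hu
  have hc : Commute a (resolvent a w) := by
    rw [sub_mul, sub_eq_iff_eq_add, ← sub_eq_iff_eq_add'] at e₁
    rw [mul_sub, sub_eq_iff_eq_add, ← sub_eq_iff_eq_add'] at e₂
    rw [Commute, SemiconjBy, ← e₁, ← e₂, Algebra.commutes]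
  exact (hc.smul_right _).eq

/-- The recursion of the moments, from `a (w - a)⁻¹ = w (w - a)⁻¹ - 1`. -/
theorem mul_resolventMoment (h : ∀ w : ℂ, w ≠ 0 → ‖w‖ < r → w ∈ resolventSet ℂ a)
    (h0 : 0 < ρ) (hr : ρ < r) (n : ℤ) :
    a * resolventMoment a ρ n = resolventMoment a ρ (n + 1) - if n = -1 then 1 else 0 := by
  have h1 := map_resolventMoment h h0 hr n (ContinuousLinearMap.mul ℂ 𝔸 a)
  simp only [ContinuousLinearMap.mul_apply'] at h1
  have h2 : (∮ w in C(0, ρ), a * w ^ n • resolvent a w) =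
      ∮ w in C(0, ρ), (w ^ (n + 1) • resolvent a w - w ^ n • (1 : 𝔸)) := by
    refine circleIntegral.integral_congr h0.le fun w hw => ?_
    simp only [mem_sphere, dist_zero_right] at hw
    have hw0 : w ≠ 0 := norm_pos_iff.1 (hw ▸ h0)
    have hu : (algebraMap ℂ 𝔸 w - a) * resolvent a w = 1 :=
      Ring.mul_inverse_cancel _ (h w hw0 (hw ▸ hr))
    rw [sub_mul, sub_eq_iff_eq_add, ← sub_eq_iff_eq_add', ← Algebra.smul_def] at hu
    rw [mul_smul_comm, ← hu, smul_sub, zpow_add_one₀ hw0, mul_smul]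
  have hi : CircleIntegrable (fun w : ℂ => w ^ n • (1 : 𝔸)) 0 ρ := by
    refine ContinuousOn.circleIntegrable h0.le fun w hw => ?_
    simp only [mem_sphere, dist_zero_right] at hw
    have hw0 : w ≠ 0 := norm_pos_iff.1 (hw ▸ h0)
    exact ((continuousAt_zpow₀ w n (Or.inl hw0)).smul
      continuousAt_const).continuousWithinAt
  rw [h1, h2, circleIntegral.integral_sub
    ((continuousOn_zpow_smul_resolvent h h0 hr (n + 1)).circleIntegrable h0.le) hi, smul_sub,
    circleIntegral.integral_smul_const, resolventMoment]
  congr 1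
  split_ifs with hn
  · subst hn
    have := circleIntegral.integral_sub_center_inv 0 h0.ne'
    simp only [sub_zero] at this
    simp only [zpow_neg_one, this, smul_smul]
    rw [inv_mul_cancel₀ (by simp [Real.pi_ne_zero]), one_smul]
  · have := circleIntegral.integral_sub_zpow_of_ne hn 0 0 ρ
    simp only [sub_zero] at this
    simp [this]

theorem exists_norm_resolventMoment_le
    (h : ∀ w : ℂ, w ≠ 0 → ‖w‖ < r → w ∈ resolventSet ℂ a) (h0 : 0 < ρ) (hr : ρ < r) :
    ∃ K : ℝ, 0 ≤ K ∧ ∀ n : ℤ, ‖resolventMoment a ρ n‖ ≤ K * ρ ^ n := by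
  have hc := continuousOn_zpow_smul_resolvent h h0 hr 0
  simp only [zpow_zero, one_smul] at hc
  obtain ⟨K, hK⟩ := (isCompact_sphere (0 : ℂ) ρ).exists_bound_of_continuousOn hc
  have hK0 : 0 ≤ K := (norm_nonneg _).trans (hK ρ (by simp [h0.le]))
  refine ⟨ρ * K, by positivity, fun n => ?_⟩
  rw [mul_assoc]
  refine circleIntegral.norm_two_pi_i_inv_smul_integral_le_of_norm_le_const h0.le fun w hw => ?_
  have hwn : ‖w‖ = ρ := by simpa using hw
  rw [norm_smul, norm_zpow, hwn, mul_comm]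
  gcongr
  exact hK w hw

/-- **Riesz decomposition** at an isolated point. If `a - w` is invertible for all small `w ≠ 0`,
then there is an idempotent `p` commuting with `a` such that `a` is invertible modulo `p` and
`aⁿ p` decays faster than any geometric sequence. -/
theorem exists_riesz_idempotent (a : 𝔸) (h : ∀ᶠ w : ℂ in 𝓝[≠] 0, w ∈ resolventSet ℂ a) :
    ∃ p s : 𝔸, p * p = p ∧ a * p = p * a ∧ a * s = 1 - p ∧ s * a = 1 - p ∧
      ∀ ε > 0, ∃ K : ℝ, ∀ n : ℕ, ‖a ^ n * p‖ ≤ K * ε ^ n := by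
  rw [eventually_nhdsWithin_iff, Metric.eventually_nhds_iff] at h
  obtain ⟨r, hr, hres⟩ := h
  replace hres : ∀ w : ℂ, w ≠ 0 → ‖w‖ < r → w ∈ resolventSet ℂ a :=
    fun w h1 h2 => hres (by simpa using h2) h1
  obtain ⟨ρ, hρ0, hρr⟩ : ∃ ρ, 0 < ρ ∧ ρ < r := ⟨r / 2, by positivity, by linarith⟩
  set m := resolventMoment a ρ with hm
  have hcomm : ∀ n, Commute a (m n) := commute_resolventMoment hres hρ0 hρr
  have hmul := mul_resolventMoment hres hρ0 hρr
  rw [← hm] at hmul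
  have hpow : ∀ n : ℕ, a ^ n * m 0 = m n := by
    intro n
    induction n with
    | zero => simp
    | succ k ih =>
      rw [pow_succ', mul_assoc, ih, hmul, if_neg (by lia)]
      simp
  have hneg : ∀ n : ℕ, a ^ (n + 1) * m (-(n + 1 : ℕ)) = m 0 - 1 := by
    intro n
    induction n with
    | zero => simpa using hmul (-1)
    | succ k ih =>
      rw [pow_succ, mul_assoc, hmul, if_neg (by lia), ← ih, sub_zero]
      congr 2
  have hbound : ∀ ε, 0 < ε → ∃ K : ℝ, 0 ≤ K ∧ ∀ n : ℕ, ‖m n‖ ≤ K * ε ^ n := by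
    intro ε hε
    have hmin : 0 < min ε ρ := lt_min hε hρ0
    obtain ⟨K, hK0, hK⟩ := exists_norm_resolventMoment_le hres hmin
      ((min_le_right _ _).trans_lt hρr)
    refine ⟨K, hK0, fun n => ?_⟩
    rw [hm, resolventMoment_eq_of_le hres hmin (min_le_right _ _) hρr]
    refine (hK n).trans ?_
    rw [zpow_natCast]
    gcongr
    exact min_le_left _ _
  have hs : a * -m (-1) = 1 - m 0 := by simp [hmul]
  refine ⟨m 0, -m (-1), ?_, hcomm 0, hs, ?_, fun ε hε => ?_⟩
  · -- `(1 - p) p = - m₋ₖ mₖ`; estimating `mₖ` on a smaller circle than `m₋ₖ` makes this tend to `0`.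
    obtain ⟨K₁, hK₁0, hK₁⟩ := hbound (ρ / 2) (by positivity)
    obtain ⟨K₂, hK₂0, hK₂⟩ := exists_norm_resolventMoment_le hres hρ0 hρr
    have hle : ∀ n : ℕ, ‖(m 0 - 1) * m 0‖ ≤ K₂ * K₁ * (1 / 2) ^ (n + 1) := by
      intro n
      have e : (m 0 - 1) * m 0 = m (-(n + 1 : ℕ)) * m (n + 1 : ℕ) := by
        rw [← hneg n, ← hpow (n + 1), ← mul_assoc, ((hcomm _).pow_left _).eq]
      rw [e]
      calc ‖m (-(n + 1 : ℕ)) * m (n + 1 : ℕ)‖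
          ≤ ‖m (-(n + 1 : ℕ))‖ * ‖m (n + 1 : ℕ)‖ := norm_mul_le _ _
        _ ≤ (K₂ * ρ ^ (-(n + 1 : ℕ) : ℤ)) * (K₁ * (ρ / 2) ^ (n + 1)) := by
          gcongr
          · exact hK₂ _
          · exact hK₁ _
        _ = K₂ * K₁ * (1 / 2) ^ (n + 1) := by
          rw [zpow_neg, zpow_natCast, div_pow, div_pow, one_pow]
          field_simp
    have hlim : Tendsto (fun n : ℕ => K₂ * K₁ * (1 / 2 : ℝ) ^ (n + 1)) atTop (𝓝 0) := by
      have := ((tendsto_pow_atTop_nhds_zero_of_lt_one (r := (1 / 2 : ℝ)) (by norm_num)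
        (by norm_num)).comp (tendsto_add_atTop_nat 1)).const_mul (K₂ * K₁)
      simpa using this
    have hz : ‖(m 0 - 1) * m 0‖ ≤ 0 := ge_of_tendsto' hlim hle
    have := norm_le_zero_iff.1 hz
    rwa [sub_mul, one_mul, sub_eq_zero] at this
  · rw [← hs]
    exact ((hcomm (-1)).neg_right).eq.symm
  · obtain ⟨K, -, hK⟩ := hbound ε hε
    exact ⟨K, fun n => by rw [hpow]; exact hK n⟩

end Riesz

/-! ### Quasi-nilpotent operators -/

section QuasiNilpotent

variable {X : Type*} [NormedAddCommGroup X] [NormedSpace ℂ X]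

theorem isUnit_sub_smul_iff_mem_resolventSet (T : X →L[ℂ] X) (w : ℂ) :
    IsUnit (T - w • ContinuousLinearMap.id ℂ X) ↔ w ∈ resolventSet ℂ T := by
  rw [spectrum.mem_resolventSet_iff, ← IsUnit.neg_iff, neg_sub, Algebra.algebraMap_eq_smul_one]
  rfl

theorem IsQuasiNilpotent.isUnit_sub_smul {T : X →L[ℂ] X} (h : IsQuasiNilpotent T) {w : ℂ}
    (hw : w ≠ 0) : IsUnit (T - w • ContinuousLinearMap.id ℂ X) := by
  rw [isUnit_sub_smul_iff_mem_resolventSet]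
  by_contra hc
  have h1 : (‖w‖₊ : ENNReal) ≤ spectralRadius ℂ T := le_iSup₂_of_le w hc le_rfl
  rw [IsQuasiNilpotent] at h
  rw [h] at h1
  simp [hw] at h1

theorem isQuasiNilpotent_of_norm_pow_le [CompleteSpace X] {T : X →L[ℂ] X}
    (h : ∀ ε > 0, ∃ K : ℝ, ∀ n : ℕ, ‖T ^ n‖ ≤ K * ε ^ n) : IsQuasiNilpotent T := by
  rw [IsQuasiNilpotent, spectralRadius, ← bot_eq_zero, iSup₂_eq_bot]
  intro k hk
  by_contra hk0
  have hk0' : 0 < ‖k‖ := by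
    rw [norm_pos_iff]
    rintro rfl
    simp at hk0
  obtain ⟨K, hK⟩ := h (‖k‖ / 2) (by positivity)
  obtain ⟨n, hn⟩ := pow_unbounded_of_one_lt (K * ‖(1 : X →L[ℂ] X)‖) (one_lt_two (α := ℝ))
  have h1 : ‖k‖ ^ n ≤ K * (‖k‖ / 2) ^ n * ‖(1 : X →L[ℂ] X)‖ := by
    rw [← norm_pow]
    refine (spectrum.norm_le_norm_mul_of_mem (spectrum.pow_mem_pow T n hk)).trans ?_
    gcongr
    exact hK n
  have h2 : 0 < ‖k‖ ^ n := by positivity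
  have h3 : K * (‖k‖ / 2) ^ n * ‖(1 : X →L[ℂ] X)‖ =
      ‖k‖ ^ n * (K * ‖(1 : X →L[ℂ] X)‖ / 2 ^ n) := by
    rw [div_pow]; ring
  rw [h3, le_mul_iff_one_le_right h2, one_le_div (by positivity)] at h1
  linarith

end QuasiNilpotent

/-! ### Null vectors of analytic families of singular matrices -/

section AnalyticGerms

/-- The functions `ℂ → ℂ` analytic at `z`, as a subring of all functions. -/
noncomputable def analyticAtSubring (z : ℂ) : Subring (ℂ → ℂ) where
  carrier := {f | AnalyticAt ℂ f z}
  mul_mem' hf hg := AnalyticAt.mul hf hg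
  one_mem' := analyticAt_const
  add_mem' hf hg := AnalyticAt.add hf hg
  zero_mem' := analyticAt_const
  neg_mem' hf := AnalyticAt.neg hf

/-- The ring of germs at `z` of functions analytic at `z`. -/
noncomputable def analyticGermSubring (z : ℂ) : Subring (Germ (𝓝 z) ℂ) :=
  (analyticAtSubring z).map (Germ.coeRingHom (𝓝 z))

/-- The germs of analytic functions form a domain, by the isolation of zeros. -/
instance isDomain_analyticGermSubring (z : ℂ) : IsDomain (analyticGermSubring z) := by
  have : NoZeroDivisors (analyticGermSubring z) := by
    constructor
    rintro ⟨_, f, hf, rfl⟩ ⟨_, g, hg, rfl⟩ hfg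
    have h1 : ∀ᶠ w in 𝓝 z, f w * g w = 0 := Germ.coe_eq.1 (congrArg Subtype.val hfg)
    rcases AnalyticAt.eventually_eq_zero_or_eventually_ne_zero hf with h | h
    · exact Or.inl (Subtype.ext (Germ.coe_eq.2 h))
    · refine Or.inr (Subtype.ext (Germ.coe_eq.2 ?_))
      rcases AnalyticAt.eventually_eq_zero_or_eventually_ne_zero hg with h' | h'
      · exact h'
      · obtain ⟨w, h2, h3, h4⟩ := (h.and (h'.and (h1.filter_mono nhdsWithin_le_nhds))).exists
        exact absurd h4 (mul_ne_zero h2 h3)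
  exact NoZeroDivisors.to_isDomain _

/-- An analytic family of matrices that is singular near `z` has an analytic family of null vectors
near `z` that does not vanish identically: matrices over the domain of analytic germs with
determinant zero have nontrivial kernel. -/
theorem exists_analyticAt_mulVec_eq_zero {d : ℕ} {N : ℂ → Matrix (Fin d) (Fin d) ℂ} {z : ℂ}
    (hN : ∀ i j, AnalyticAt ℂ (fun w => N w i j) z) (hdet : ∀ᶠ w in 𝓝 z, (N w).det = 0) :
    ∃ v : ℂ → Fin d → ℂ, (∀ i, AnalyticAt ℂ (fun w => v w i) z) ∧
      (∀ᶠ w in 𝓝 z, (N w).mulVec (v w) = 0) ∧ ¬ ∀ᶠ w in 𝓝 z, v w = 0 := by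
  let M : Matrix (Fin d) (Fin d) (ℂ → ℂ) := Matrix.of fun i j w => N w i j
  let MG : Matrix (Fin d) (Fin d) (analyticGermSubring z) :=
    Matrix.of fun i j => ⟨(fun w => N w i j : ℂ → ℂ), _, hN i j, rfl⟩
  have hMG : MG.det = 0 := by
    refine Subtype.ext ?_
    have h1 : ((MG.det : analyticGermSubring z) : Germ (𝓝 z) ℂ) =
        Germ.coeRingHom (𝓝 z) M.det := by
      rw [RingHom.map_det]
      exact RingHom.map_det (analyticGermSubring z).subtype MG
    have h2 : M.det = fun w => (N w).det := by
      funext w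
      exact RingHom.map_det (Pi.evalRingHom (fun _ : ℂ => ℂ) w) M
    rw [h1, h2]
    exact Germ.coe_eq.2 hdet
  obtain ⟨v, hv0, hv⟩ := Matrix.exists_mulVec_eq_zero_iff.2 hMG
  choose f hf hfv using fun i => (v i).2
  refine ⟨fun w i => f i w, hf, ?_, fun h0 => hv0 ?_⟩
  · have : ∀ i, ∀ᶠ w in 𝓝 z, ((N w).mulVec fun j => f j w) i = 0 := by
      intro i
      have h3 := congrArg Subtype.val (congrFun hv i)
      have h4 : (((MG.mulVec v) i : analyticGermSubring z) : Germ (𝓝 z) ℂ) =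
          Germ.coeRingHom (𝓝 z) (fun w => ((N w).mulVec fun j => f j w) i) := by
        have h5 : (fun w => ((N w).mulVec fun j => f j w) i) = ∑ j, M i j * f j := by
          funext w
          simp [Matrix.mulVec, dotProduct, M]
        rw [h5, map_sum]
        simp only [map_mul, hfv, Matrix.mulVec, dotProduct]
        exact map_sum (analyticGermSubring z).subtype _ _
      rw [h4] at h3
      exact Germ.coe_eq.1 h3
    filter_upwards [eventually_all.2 this] with w hw using funext hw
  · funext i
    refine Subtype.ext ?_
    rw [← hfv i]
    exact Germ.coe_eq.2 (h0.mono fun w hw => congrFun hw i)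

end AnalyticGerms

/-! ### Weyl operators and the SVEP -/

section Weyl

variable {X : Type*} [NormedAddCommGroup X] [NormedSpace ℂ X] [CompleteSpace X]

theorem isWeyl_of_bijective {T : X →L[ℂ] X} (h : Function.Bijective T) : IsWeyl T := by
  have hu : T.IsFredholm := by
    obtain ⟨e, rfl⟩ := ContinuousLinearMap.isUnit_iff_bijective.2 h
    refine ContinuousLinearMap.IsFredholm.of_isQuasiInverse (v := ↑e⁻¹) ⟨?_, ?_⟩
    · have : ((↑e⁻¹ : X →L[ℂ] X) : X →ₗ[ℂ] X) ∘ₗ ((e : X →L[ℂ] X) : X →ₗ[ℂ] X) = .id :=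
        congrArg (fun S : X →L[ℂ] X => (S : X →ₗ[ℂ] X)) e.inv_mul
      rw [LinearMap.IsLeftQuasiInverse, this]
    · have : ((e : X →L[ℂ] X) : X →ₗ[ℂ] X) ∘ₗ ((↑e⁻¹ : X →L[ℂ] X) : X →ₗ[ℂ] X) = .id :=
        congrArg (fun S : X →L[ℂ] X => (S : X →ₗ[ℂ] X)) e.mul_inv
      rw [LinearMap.IsRightQuasiInverse, this]
  refine ⟨hu, ?_⟩
  have h1 : LinearMap.ker (T : X →ₗ[ℂ] X) = ⊥ := LinearMap.ker_eq_bot.2 h.1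
  have h2 : LinearMap.range (T : X →ₗ[ℂ] X) = ⊤ := LinearMap.range_eq_top.2 h.2
  have h3 : Module.finrank ℂ (X ⧸ LinearMap.range (T : X →ₗ[ℂ] X)) = 0 := by
    have := Submodule.Quotient.subsingleton_iff.2 h2
    exact Module.finrank_zero_of_subsingleton
  rw [index, h3, h1]
  simp

/-- A Weyl operator is a finite-rank perturbation of an invertible operator: add an isomorphism of
the kernel onto a complement of the range. -/
theorem IsWeyl.exists_isUnit_add {T : X →L[ℂ] X} (h : IsWeyl T) :
    ∃ (d : ℕ) (i : (Fin d → ℂ) →L[ℂ] X) (p : X →L[ℂ] (Fin d → ℂ)), IsUnit (T + i ∘L p) := by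
  obtain ⟨hF, hind⟩ := h
  have hfk : FiniteDimensional ℂ (LinearMap.ker (T : X →ₗ[ℂ] X)) := hF.finite_ker
  have hfc : FiniteDimensional ℂ (X ⧸ LinearMap.range (T : X →ₗ[ℂ] X)) := hF.finite_coker
  obtain ⟨P, hP⟩ := hF.closedComplemented_ker
  obtain ⟨D, hD⟩ := (LinearMap.range (T : X →ₗ[ℂ] X)).exists_isCompl
  have eD := Submodule.quotientEquivOfIsCompl _ D hD
  have hfD : FiniteDimensional ℂ D := eD.finiteDimensional
  have hrank : Module.finrank ℂ (LinearMap.ker (T : X →ₗ[ℂ] X)) = Module.finrank ℂ D := by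
    rw [← eD.finrank_eq]
    rw [index, sub_eq_zero] at hind
    exact_mod_cast hind
  set d := Module.finrank ℂ (LinearMap.ker (T : X →ₗ[ℂ] X)) with hd
  let eK : LinearMap.ker (T : X →ₗ[ℂ] X) ≃L[ℂ] (Fin d → ℂ) :=
    ContinuousLinearEquiv.ofFinrankEq (by simp [hd])
  let eR : (Fin d → ℂ) ≃L[ℂ] D := ContinuousLinearEquiv.ofFinrankEq (by simp [hrank])
  refine ⟨d, D.subtypeL ∘L (eR : (Fin d → ℂ) →L[ℂ] D),
    (eK : LinearMap.ker (T : X →ₗ[ℂ] X) →L[ℂ] (Fin d → ℂ)) ∘L P, ?_⟩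
  rw [ContinuousLinearMap.isUnit_iff_bijective]
  have happ : ∀ x, (T + (D.subtypeL ∘L (eR : (Fin d → ℂ) →L[ℂ] D)) ∘L
      ((eK : LinearMap.ker (T : X →ₗ[ℂ] X) →L[ℂ] (Fin d → ℂ)) ∘L P)) x =
      T x + (eR (eK (P x)) : X) := fun x => rfl
  constructor
  · rw [injective_iff_map_eq_zero]
    intro x hx
    rw [happ] at hx
    have h1 : T x ∈ D := by
      rw [eq_neg_of_add_eq_zero_left hx]
      exact D.neg_mem (eR (eK (P x))).2
    have h2 : T x = 0 := Submodule.disjoint_def.1 hD.disjoint _ ⟨x, rfl⟩ h1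
    rw [h2, zero_add] at hx
    have h3 : P x = 0 := by simpa using hx
    have h4 := hP ⟨x, h2⟩
    have h5 : P x = ⟨x, h2⟩ := h4
    rw [h3] at h5
    exact (congrArg Subtype.val h5).symm
  · intro y
    obtain ⟨_, ⟨x₀, rfl⟩, c, hc, rfl⟩ := Submodule.mem_sup.1
      (hD.sup_eq_top ▸ Submodule.mem_top : y ∈ _ ⊔ D)
    obtain ⟨k, hk⟩ : ∃ k, eR (eK k) = ⟨c, hc⟩ := ⟨eK.symm (eR.symm ⟨c, hc⟩), by simp⟩
    refine ⟨x₀ - P x₀ + k, ?_⟩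
    have hT : ∀ k : LinearMap.ker (T : X →ₗ[ℂ] X), T k = 0 := fun k => k.2
    rw [happ, map_add, map_sub, hT, hT, map_add P, map_sub P, hP, hP, sub_self, zero_add, hk]
    simp

/-- If a finite-rank perturbation of `T` is invertible and `T` or its adjoint has the SVEP, then
`T - w` is invertible for all small `w ≠ 0`. With `G w = T + i p - w`, the invertibility of `T - w`
is that of the matrix `1 - p (G w)⁻¹ i`. If the latter were singular for all small `w`, analytic
null vectors `v w` on the right and `u w` on the left would give the eigenvectors `(G w)⁻¹ i (v w)`
of `T` and the eigenfunctionals `(u w) p (G w)⁻¹` of its adjoint. -/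
theorem eventually_isUnit_sub_smul_of_isUnit_add {T : X →L[ℂ] X} {d : ℕ}
    (i : (Fin d → ℂ) →L[ℂ] X) (p : X →L[ℂ] (Fin d → ℂ)) (hG : IsUnit (T + i ∘L p))
    (hT : HasSVEP T ∨ HasSVEP (dualOp T)) :
    ∀ᶠ w in 𝓝[≠] (0 : ℂ), IsUnit (T - w • ContinuousLinearMap.id ℂ X) := by
  let G : ℂ → X →L[ℂ] X := fun w => T + i ∘L p - w • ContinuousLinearMap.id ℂ X
  let R : ℂ → X →L[ℂ] X := fun w => Ring.inverse (G w)
  let N : ℂ → Matrix (Fin d) (Fin d) ℂ := fun w =>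
    LinearMap.toMatrix' ((ContinuousLinearMap.id ℂ (Fin d → ℂ) - p ∘L R w ∘L i :
      (Fin d → ℂ) →L[ℂ] (Fin d → ℂ)) : (Fin d → ℂ) →ₗ[ℂ] (Fin d → ℂ))
  have hNv : ∀ w e, (N w).mulVec e = e - p (R w (i e)) := fun w e => by
    simp only [N, LinearMap.toMatrix'_mulVec]
    rfl
  have hGan : AnalyticAt ℂ G 0 := by
    refine analyticAt_const.sub ?_
    exact AnalyticAt.smul (f := fun w : ℂ => w) analyticAt_id analyticAt_const
  have hG0 : IsUnit (G 0) := by simpa [G] using hG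
  have hGev : ∀ᶠ w in 𝓝 (0 : ℂ), IsUnit (G w) :=
    hGan.continuousAt.eventually (Units.isOpen.mem_nhds hG0)
  have hRan : AnalyticAt ℂ R 0 := by
    obtain ⟨u, hu⟩ := hG0
    exact (analyticAt_inverse (𝕜 := ℂ) u).comp_of_eq hGan hu.symm
  have hGR : ∀ w, IsUnit (G w) → ∀ x, G w (R w x) = x := fun w hw x =>
    congrArg (fun S : X →L[ℂ] X => S x) (Ring.mul_inverse_cancel _ hw)
  have hRG : ∀ w, IsUnit (G w) → ∀ x, R w (G w x) = x := fun w hw x =>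
    congrArg (fun S : X →L[ℂ] X => S x) (Ring.inverse_mul_cancel _ hw)
  have hGT : ∀ w x, G w x = (T x - w • x) + i (p x) := fun w x => by
    simp [G]; abel
  have hNan : ∀ j k, AnalyticAt ℂ (fun w => N w j k) 0 := by
    intro j k
    have e : (fun w => N w j k) = fun w => (Pi.single k 1 : Fin d → ℂ) j -
        (ContinuousLinearMap.proj (R := ℂ) (φ := fun _ : Fin d => ℂ) j ∘L p ∘L
          ContinuousLinearMap.apply ℂ X (i (Pi.single k 1))) (R w) := by
      funext w
      have h1 := congrFun (hNv w (Pi.single k 1)) j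
      rw [Matrix.mulVec_single_one] at h1
      exact h1
    rw [e]
    exact analyticAt_const.sub ((ContinuousLinearMap.analyticAt _ _).comp hRan)
  have hdetan : AnalyticAt ℂ (fun w => (N w).det) 0 := by
    simp only [Matrix.det_apply']
    refine Finset.analyticAt_fun_sum _ fun σ _ => ?_
    exact analyticAt_const.mul (Finset.analyticAt_fun_prod _ fun j _ => hNan _ _)
  rcases hdetan.eventually_eq_zero_or_eventually_ne_zero with hdet | hdet
  · exfalso
    rcases hT with hT | hT
    · obtain ⟨v, hvan, hv, hv0⟩ := exists_analyticAt_mulVec_eq_zero hNan hdet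
      rw [hasSVEP_iff] at hT
      have hvan' : AnalyticAt ℂ v 0 := analyticAt_pi_iff.2 hvan
      have hfan : AnalyticAt ℂ (fun w => R w (i (v w))) 0 :=
        AnalyticAt.comp₂ (h := fun q : (X →L[ℂ] X) × X => q.1 q.2)
          ((ContinuousLinearMap.id ℂ (X →L[ℂ] X)).analyticAt_bilinear _) hRan
          ((i.analyticAt _).comp hvan')
      obtain ⟨U, hU, hUo, hU0⟩ := _root_.eventually_nhds_iff.1
        (hfan.eventually_analyticAt.and (hGev.and hv))
      refine hv0 (eventually_of_mem (hUo.mem_nhds hU0) fun w hw => ?_)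
      have hNw : v w - p (R w (i (v w))) = 0 := by rw [← hNv]; exact (hU w hw).2.2
      have hz := hT U hUo (fun w => R w (i (v w))) (fun w hw => (hU w hw).1) ?_ w hw
      · simpa [hz] using hNw
      · intro w hw
        have hNw : v w - p (R w (i (v w))) = 0 := by rw [← hNv]; exact (hU w hw).2.2
        have h1 := hGT w (R w (i (v w)))
        rw [hGR w (hU w hw).2.1, ← sub_eq_zero.1 hNw, right_eq_add] at h1
        simpa using h1
    · obtain ⟨u, huan, hu, hu0⟩ := exists_analyticAt_mulVec_eq_zero
        (N := fun w => (N w).transpose) (fun j k => hNan k j)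
        (hdet.mono fun w hw => by rw [Matrix.det_transpose, hw])
      rw [hasSVEP_iff] at hT
      let φ : ℂ → StrongDual ℂ X := fun w =>
        ∑ j, u w j • (ContinuousLinearMap.proj (R := ℂ) (φ := fun _ : Fin d => ℂ) j ∘L p ∘L R w)
      have hφ : ∀ w x, φ w x = u w ⬝ᵥ p (R w x) := fun w x => by
        simp [φ, dotProduct]
      have hφan : AnalyticAt ℂ φ 0 := by
        refine Finset.analyticAt_fun_sum _ fun j _ => (huan j).smul ?_
        exact ((ContinuousLinearMap.compL ℂ X X ℂ
          (ContinuousLinearMap.proj (R := ℂ) (φ := fun _ : Fin d => ℂ) j ∘L p)).analyticAt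
            _).comp hRan
      obtain ⟨U, hU, hUo, hU0⟩ := _root_.eventually_nhds_iff.1
        (hφan.eventually_analyticAt.and (hGev.and hu))
      have huN : ∀ w ∈ U, ∀ e, φ w (i e) = u w ⬝ᵥ e := fun w hw e => by
        have h1 : u w ⬝ᵥ (N w).mulVec e = 0 := by
          rw [Matrix.dotProduct_mulVec, ← Matrix.mulVec_transpose, (hU w hw).2.2,
            zero_dotProduct]
        rw [hNv, dotProduct_sub, sub_eq_zero] at h1
        rw [hφ, h1]
      refine hu0 (eventually_of_mem (hUo.mem_nhds hU0) fun w hw => ?_)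
      have hz := hT U hUo φ (fun w hw => (hU w hw).1) ?_ w hw
      · refine dotProduct_eq_zero _ fun e => ?_
        rw [← huN w hw, hz]
        rfl
      · intro w hw
        ext x
        have h1 : φ w (G w x) = φ w (i (p x)) := by
          rw [huN w hw, hφ, hRG w (hU w hw).2.1]
        rw [hGT, map_add, add_eq_right] at h1
        simpa [dualOp] using h1
  · filter_upwards [hdet, hGev.filter_mono nhdsWithin_le_nhds] with w hw hGw
    have hNu : IsUnit (N w) := (Matrix.isUnit_iff_isUnit_det _).2 (isUnit_iff_ne_zero.2 hw)
    rw [ContinuousLinearMap.isUnit_iff_bijective]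
    constructor
    · rw [injective_iff_map_eq_zero]
      intro x hx
      have hx' : T x - w • x = 0 := by simpa using hx
      have h1 := hGT w x
      rw [hx', zero_add] at h1
      have h2 : x = R w (i (p x)) := by rw [← h1, hRG w hGw]
      have h3 : (N w).mulVec (p x) = 0 := by rw [hNv, ← h2, sub_self]
      have h4 : p x = 0 := (Matrix.mulVec_injective_iff_isUnit.2 hNu) (by rw [h3, Matrix.mulVec_zero])
      rw [h2, h4]
      simp
    · intro y
      obtain ⟨e, he⟩ := (Matrix.mulVec_surjective_iff_isUnit.2 hNu) (p (R w y))
      rw [hNv] at he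
      refine ⟨R w (y + i e), ?_⟩
      have h1 := hGT w (R w (y + i e))
      have h2 : p (R w (y + i e)) = e := by
        rw [map_add (R w), map_add p, ← he, sub_add_cancel]
      rw [hGR w hGw, h2, add_left_inj] at h1
      simpa using h1.symm

end Weyl

/-! ### Pseudo B-Weyl operators and accumulation points of the spectrum -/

section PseudoBWeyl

variable {X : Type*} [NormedAddCommGroup X] [NormedSpace ℂ X] [CompleteSpace X]

/-- If `T - w` is invertible for all small `w ≠ 0`, then the Riesz idempotent splits `T` into an
invertible and a quasi-nilpotent part. -/
theorem isPseudoBWeyl_of_eventually_isUnit {T : X →L[ℂ] X}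
    (h : ∀ᶠ w in 𝓝[≠] (0 : ℂ), IsUnit (T - w • ContinuousLinearMap.id ℂ X)) :
    IsPseudoBWeyl T := by
  simp only [isUnit_sub_smul_iff_mem_resolventSet] at h
  obtain ⟨p, s, hpp, hTp, hTs, hsT, hpow⟩ := exists_riesz_idempotent T h
  have hpp' : ∀ x, p (p x) = p x := fun x => congrArg (fun S : X →L[ℂ] X => S x) hpp
  have hTp' : ∀ x, T (p x) = p (T x) := fun x => congrArg (fun S : X →L[ℂ] X => S x) hTp
  have hTs' : ∀ x, T (s x) = x - p x := fun x => congrArg (fun S : X →L[ℂ] X => S x) hTs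
  have hsT' : ∀ x, s (T x) = x - p x := fun x => congrArg (fun S : X →L[ℂ] X => S x) hsT
  let X₁ : Submodule ℂ X := p.ker
  let X₂ : Submodule ℂ X := (1 - p).ker
  have mem₁ : ∀ {x}, x ∈ X₁ ↔ p x = 0 := Iff.rfl
  have mem₂ : ∀ {x}, x ∈ X₂ ↔ p x = x := fun {x} => by
    rw [eq_comm, ← sub_eq_zero]; rfl
  have h₁ : MapsTo T X₁ X₁ := fun x hx => by
    rw [SetLike.mem_coe, mem₁] at hx ⊢
    rw [← hTp', hx, map_zero]
  have h₂ : MapsTo T X₂ X₂ := fun x hx => by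
    rw [SetLike.mem_coe, mem₂] at hx ⊢
    rw [← hTp', hx]
  have hc₁ : IsClosed (X₁ : Set X) := p.isClosed_ker
  have hc₂ : IsClosed (X₂ : Set X) := (1 - p).isClosed_ker
  have := hc₁.completeSpace_coe
  have := hc₂.completeSpace_coe
  refine ⟨X₁, X₂, h₁, h₂, hc₁, hc₂, ⟨?_, ?_⟩, isWeyl_of_bijective ⟨?_, ?_⟩, ?_⟩
  · rw [Submodule.disjoint_def]
    intro x hx hx'
    rw [← mem₂.1 hx', mem₁.1 hx]
  · rw [codisjoint_iff, eq_top_iff]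
    intro x _
    refine Submodule.mem_sup.2 ⟨x - p x, ?_, p x, mem₂.2 (hpp' x), sub_add_cancel _ _⟩
    rw [mem₁, map_sub, hpp', sub_self]
  · rw [injective_iff_map_eq_zero]
    rintro ⟨x, hx⟩ hx'
    have hTx : T x = 0 := congrArg Subtype.val hx'
    have := hsT' x
    rw [hTx, map_zero, mem₁.1 hx, sub_zero] at this
    exact Subtype.ext this.symm
  · rintro ⟨y, hy⟩
    refine ⟨⟨s y - p (s y), ?_⟩, Subtype.ext ?_⟩
    · rw [mem₁, map_sub, hpp', sub_self]
    · change T (s y - p (s y)) = y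
      rw [map_sub, hTp', hTs', map_sub, hpp', mem₁.1 hy]
      simp
  · refine isQuasiNilpotent_of_norm_pow_le fun ε hε => ?_
    obtain ⟨K, hK⟩ := hpow ε hε
    refine ⟨K, fun n => ContinuousLinearMap.opNorm_le_bound _
      ((norm_nonneg _).trans (hK n)) fun x => ?_⟩
    have e : ∀ n : ℕ, ((((T.restrict h₂) ^ n) x : X₂) : X) = (T ^ n) x := by
      intro n
      induction n with
      | zero => rfl
      | succ k ih =>
        rw [pow_succ', pow_succ']
        change T ((((T.restrict h₂) ^ k) x : X₂) : X) = T ((T ^ k) x)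
        rw [ih]
    have e' : (T ^ n) (x : X) = (T ^ n * p) x := by
      change (T ^ n) (x : X) = (T ^ n) (p x)
      rw [mem₂.1 x.2]
    rw [Submodule.coe_norm, e, e']
    exact (T ^ n * p).le_of_opNorm_le (hK n) _

/-- If `T` or its adjoint has the SVEP, then the Weyl summand of a pseudo B-Weyl operator `T` is
invertible near `0` off `0`, so that the spectrum of `T` does not accumulate at `0`. -/
theorem IsPseudoBWeyl.eventually_isUnit {T : X →L[ℂ] X} (h : IsPseudoBWeyl T)
    (hT : HasSVEP T ∨ HasSVEP (dualOp T)) :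
    ∀ᶠ w in 𝓝[≠] (0 : ℂ), IsUnit (T - w • ContinuousLinearMap.id ℂ X) := by
  obtain ⟨X₁, X₂, h₁, h₂, hc₁, hc₂, hX, hW, hQ⟩ := h
  have := hc₁.completeSpace_coe
  have := hc₂.completeSpace_coe
  have hXt := Submodule.IsCompl.isTopCompl_of_isClosed hX hc₁ hc₂
  have hT₁ : HasSVEP (T.restrict h₁) ∨ HasSVEP (dualOp (T.restrict h₁)) := by
    refine hT.imp (fun h => h.of_intertwines X₁.subtypeL Subtype.val_injective fun y => rfl)
      fun h => ?_
    let P : X →L[ℂ] X₁ := X₁.projectionOntoL X₂ hXt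
    have hPT : ∀ x, P (T x) = T.restrict h₁ (P x) := by
      intro x
      obtain ⟨x₁, hx₁, x₂, hx₂, rfl⟩ := Submodule.mem_sup.1
        (hX.sup_eq_top ▸ Submodule.mem_top : x ∈ X₁ ⊔ X₂)
      have e₂ : ∀ {x}, x ∈ X₂ → P x = 0 := fun hx =>
        Submodule.projectionOntoL_apply_eq_zero_of_mem_right hXt hx
      have e₁ : ∀ x : X₁, P x = x := Submodule.projectionOntoL_apply_left hXt
      rw [map_add, map_add, map_add, e₂ hx₂, e₂ (h₂ hx₂), e₁ ⟨x₁, hx₁⟩, add_zero, add_zero]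
      exact e₁ ⟨T x₁, h₁ hx₁⟩
    refine h.of_intertwines (ContinuousLinearMap.precomp ℂ P) ?_ ?_
    · intro φ ψ hφψ
      ext x
      obtain ⟨y, rfl⟩ := Submodule.projectionOntoL_surjective hXt x
      exact congrArg (fun χ : StrongDual ℂ X => χ y) hφψ
    · intro φ
      ext x
      exact congrArg φ (hPT x)
  obtain ⟨d, i, p, hG⟩ := hW.exists_isUnit_add
  filter_upwards [eventually_isUnit_sub_smul_of_isUnit_add i p hG hT₁, self_mem_nhdsWithin]
    with w hw hw0
  have hw₂ := hQ.isUnit_sub_smul (w := w) hw0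
  rw [ContinuousLinearMap.isUnit_iff_bijective] at hw hw₂ ⊢
  constructor
  · rw [injective_iff_map_eq_zero]
    intro x hx
    obtain ⟨x₁, hx₁, x₂, hx₂, rfl⟩ := Submodule.mem_sup.1
      (hX.sup_eq_top ▸ Submodule.mem_top : x ∈ X₁ ⊔ X₂)
    have hx' : (T x₁ - w • x₁) + (T x₂ - w • x₂) = 0 := by
      rw [← hx]; simp; abel
    have m₁ : T x₁ - w • x₁ ∈ X₁ := X₁.sub_mem (h₁ hx₁) (X₁.smul_mem w hx₁)
    have m₂ : T x₂ - w • x₂ ∈ X₂ := X₂.sub_mem (h₂ hx₂) (X₂.smul_mem w hx₂)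
    have z₁ : T x₁ - w • x₁ = 0 := Submodule.disjoint_def.1 hX.disjoint _ m₁ (by
      rw [eq_neg_of_add_eq_zero_left hx']
      exact X₂.neg_mem m₂)
    have z₂ : T x₂ - w • x₂ = 0 := by rwa [z₁, zero_add] at hx'
    have y₁ := (injective_iff_map_eq_zero _).1 hw.1 ⟨x₁, hx₁⟩ (Subtype.ext z₁)
    have y₂ := (injective_iff_map_eq_zero _).1 hw₂.1 ⟨x₂, hx₂⟩ (Subtype.ext z₂)
    rw [show x₁ = 0 from congrArg Subtype.val y₁, show x₂ = 0 from congrArg Subtype.val y₂,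
      add_zero]
  · intro y
    obtain ⟨y₁, hy₁, y₂, hy₂, rfl⟩ := Submodule.mem_sup.1
      (hX.sup_eq_top ▸ Submodule.mem_top : y ∈ X₁ ⊔ X₂)
    obtain ⟨x₁, hx₁⟩ := hw.2 ⟨y₁, hy₁⟩
    obtain ⟨x₂, hx₂⟩ := hw₂.2 ⟨y₂, hy₂⟩
    refine ⟨x₁ + x₂, ?_⟩
    rw [map_add]
    exact congrArg₂ (· + ·) (congrArg Subtype.val hx₁) (congrArg Subtype.val hx₂)

/-- If `T` or its adjoint has the SVEP, then the pseudo B-Weyl spectrum of `T` is the set of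
accumulation points of its spectrum. -/
theorem notMem_pBWSpectrum_iff {T : X →L[ℂ] X} (hT : HasSVEP T ∨ HasSVEP (dualOp T)) (z : ℂ) :
    z ∉ pBWSpectrum T ↔
      ∀ᶠ w in 𝓝[≠] (0 : ℂ), IsUnit (T - z • ContinuousLinearMap.id ℂ X -
        w • ContinuousLinearMap.id ℂ X) := by
  rw [pBWSpectrum, mem_ofPred_eq, not_not]
  refine ⟨fun h => h.eventually_isUnit (hT.imp (fun h => h.sub_smul z) fun h => ?_),
    isPseudoBWeyl_of_eventually_isUnit⟩
  rw [dualOp_sub_smul]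
  exact h.sub_smul z

end PseudoBWeyl

end PseudoBWeyl

theorem mainTheorem10
    {X : Type*} [NormedAddCommGroup X] [NormedSpace ℂ X] [CompleteSpace X]
    {Y : Type*} [NormedAddCommGroup Y] [NormedSpace ℂ Y] [CompleteSpace Y]
    (A : X →L[ℂ] X) (B : Y →L[ℂ] Y)
    (h : (PseudoBWeyl.HasSVEP A ∧ PseudoBWeyl.HasSVEP B) ∨
      (PseudoBWeyl.HasSVEP (PseudoBWeyl.dualOp A) ∧
        PseudoBWeyl.HasSVEP (PseudoBWeyl.dualOp B)))
    (C : Y →L[ℂ] X) :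
    PseudoBWeyl.pBWSpectrum (PseudoBWeyl.upperTriangular A B C) =
      PseudoBWeyl.pBWSpectrum A ∪ PseudoBWeyl.pBWSpectrum B := by
  open PseudoBWeyl in
  ext z
  have hA := h.imp And.left And.left
  have hB := h.imp And.right And.right
  have hM : HasSVEP (upperTriangular A B C) ∨ HasSVEP (dualOp (upperTriangular A B C)) :=
    h.imp (fun h => hasSVEP_upperTriangular h.1 h.2 C)
      fun h => hasSVEP_dualOp_upperTriangular h.1 h.2 C
  rw [← not_iff_not, mem_union, not_or, notMem_pBWSpectrum_iff hM, notMem_pBWSpectrum_iff hA,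
    notMem_pBWSpectrum_iff hB, ← eventually_and]
  refine eventually_congr (Eventually.of_forall fun w => ?_)
  rw [upperTriangular_sub_smul, upperTriangular_sub_smul]
  refine isUnit_upperTriangular_iff (h.imp (fun h => (h.2.sub_smul z).sub_smul w) fun h => ?_) C
  rw [dualOp_sub_smul, dualOp_sub_smul]
  exact (h.1.sub_smul z).sub_smul w
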